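/- Let $p$ be a prime number and let $G$ be a $p$-adic analytic group, i.e. a topological group which carries the structure of a finite-dimensional analytic manifold over $\mathbb{Q}_p$ such that multiplication and inversion are analytic. Let $k$ be a field of positive characteristic (not necessarily equal to $p$). Let $\mathrm{Rep}_k(G)$ be the category of all representations of the abstract group $G$ on $k$-vector spaces, and let $\mathrm{Rep}_k^{\mathrm{sm}}(G)$ be its full subcategory of smooth representations, i.e. of those $V$ for which the action map $G\times V\to V$ is continuous when $V$ carries the discrete topology. For $V\in\mathrm{Rep}_k(G)$ put $V^{\mathrm{sm}}=\bigcup_K V^K$, where $K$ runs through the compact open subgroups of $G$ and $V^K$ is the subspace of $K$-fixed vectors. This defines a left exact functor $$\mathrm{sm}\colon \mathrm{Rep}_k(G)\longrightarrow \mathrm{Rep}_k^{\mathrm{sm}}(G),\qquad V\longmapsto V^{\mathrm{sm}}.$$ Then for every smooth representation $V\in\mathrm{Rep}_k^{\mathrm{sm}}(G)$ the first right derived functor of $\mathrm{sm}$ vanishes on $V$: $$\mathbf{R}^1\mathrm{sm}(V)=\{0\}.$$ -/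

import Mathlib

open CategoryTheory CategoryTheory.Limits
open scoped Manifold ContDiff

universe u v w

/-- A `p`-adic analytic group: a topological space with a group structure that carries the structure
of a finite-dimensional analytic manifold over `ℚ_p` for which multiplication and inversion
are analytic maps. (The dimension is constant, by homogeneity.) -/
def IsPadicAnalyticGroup (p : ℕ) [Fact p.Prime] (G : Type v) [Group G] [TopologicalSpace G] :
    Prop :=
  ∃ (d : ℕ) (_ : ChartedSpace (Fin d → ℚ_[p]) G),
    LieGroup 𝓘(ℚ_[p], Fin d → ℚ_[p]) ω G

namespace SmoothRep

instance enoughInjectives_rep (k : Type u) [Field k] (G : Type v) [Group G] :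
    EnoughInjectives (Rep.{max u v w} k G) := by
  have : EnoughInjectives (ModuleCat.{max u v w} (MonoidAlgebra k G)) := inferInstance
  exact EnoughInjectives.of_equivalence (Rep.toModuleMonoidAlgebra (k := k) (G := G))

variable {k : Type u} [Field k] {G : Type v} [Group G]

/-- The subspace `V ^ K` of vectors fixed by the subgroup `K`. -/
noncomputable def fixedBy (V : Rep.{w} k G) (K : Subgroup G) : Submodule k V :=
  Representation.invariants (V.ρ.comp K.subtype)

lemma mem_fixedBy {V : Rep.{w} k G} {K : Subgroup G} {x : V} :
    x ∈ fixedBy V K ↔ ∀ g ∈ K, V.ρ g x = x := by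
  simp [fixedBy, Representation.mem_invariants]

variable (k G) [TopologicalSpace G]

/-- A representation `V` is smooth if the action map `G × V → V` is continuous for the discrete
topology on `V`. -/
def IsSmooth : ObjectProperty (Rep.{w} k G) := fun V =>
  letI : TopologicalSpace V := ⊥
  Continuous fun x : G × V => V.ρ x.1 x.2

/-- The category of smooth representations, a full subcategory of `Rep k G`. -/
abbrev SmRep : Type (max u v (w + 1)) := (IsSmooth.{u, v, w} k G).FullSubcategory

variable {k G}

/-- The smooth part of `V`: the union of the subspaces `V ^ K`, where `K` runs through the compact
open subgroups of `G`. It is written as a sum of subspaces. The sum is a union as soon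
as `G` has some compact open subgroup, see `mem_smoothPart_iff`. -/
noncomputable def smoothPart (V : Rep.{w} k G) : Submodule k V :=
  ⨆ K : {K : Subgroup G // IsCompact (K : Set G) ∧ IsOpen (K : Set G)}, fixedBy V K.1

lemma mem_smoothPart_iff [IsTopologicalGroup G]
    (hG : ∃ K : Subgroup G, IsCompact (K : Set G) ∧ IsOpen (K : Set G))
    {V : Rep.{w} k G} {x : V} :
    x ∈ smoothPart V ↔
      ∃ K : Subgroup G, IsCompact (K : Set G) ∧ IsOpen (K : Set G) ∧ ∀ g ∈ K, V.ρ g x = x := by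
  have : Nonempty {K : Subgroup G // IsCompact (K : Set G) ∧ IsOpen (K : Set G)} :=
    ⟨⟨hG.choose, hG.choose_spec⟩⟩
  rw [smoothPart, Submodule.mem_iSup_of_directed]
  · simp only [mem_fixedBy, Subtype.exists, exists_prop, and_assoc]
  · intro K L
    refine ⟨⟨K.1 ⊓ L.1, ?_, ?_⟩, fun x hx => ?_, fun x hx => ?_⟩
    · rw [Subgroup.coe_inf]
      exact K.2.1.inter_right (L.1.isClosed_of_isOpen L.2.2)
    · rw [Subgroup.coe_inf]
      exact K.2.2.inter L.2.2
    · exact mem_fixedBy.2 fun g hg => mem_fixedBy.1 hx g hg.1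
    · exact mem_fixedBy.2 fun g hg => mem_fixedBy.1 hx g hg.2

lemma exists_isOpen_of_mem_smoothPart (V : Rep.{w} k G) {x : V} (hx : x ∈ smoothPart V) :
    ∃ K : Subgroup G, IsOpen (K : Set G) ∧ ∀ g ∈ K, V.ρ g x = x := by
  refine Submodule.iSup_induction _ (motive := fun x : V =>
    ∃ K : Subgroup G, IsOpen (K : Set G) ∧ ∀ g ∈ K, V.ρ g x = x) hx ?_ ?_ ?_
  · exact fun K x hx => ⟨K.1, K.2.2, mem_fixedBy.1 hx⟩
  · exact ⟨⊤, by simp, by simp⟩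
  · rintro x y ⟨K, hK, hx⟩ ⟨L, hL, hy⟩
    refine ⟨K ⊓ L, ?_, fun g hg => by rw [map_add, hx g hg.1, hy g hg.2]⟩
    rw [Subgroup.coe_inf]
    exact hK.inter hL

lemma map_mem_smoothPart {V W : Rep.{w} k G} (f : V ⟶ W) {x : V} (hx : x ∈ smoothPart V) :
    f.hom x ∈ smoothPart W := by
  have : smoothPart V ≤ (smoothPart W).comap f.hom.toLinearMap := by
    refine iSup_le fun K x hx => ?_
    refine (le_iSup (fun K : {K : Subgroup G // IsCompact (K : Set G) ∧ IsOpen (K : Set G)} =>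
      fixedBy W K.1) K) (mem_fixedBy.2 fun g hg => ?_)
    exact (Rep.hom_comm_apply f g x).symm.trans (congrArg f.hom (mem_fixedBy.1 hx g hg))
  exact this hx

variable [IsTopologicalGroup G]

/-- A representation is smooth if and only if every vector is fixed by some open subgroup. -/
lemma isSmooth_iff (V : Rep.{w} k G) :
    IsSmooth k G V ↔
      ∀ x : V, ∃ K : Subgroup G, IsOpen (K : Set G) ∧ ∀ g ∈ K, V.ρ g x = x := by
  let _ : TopologicalSpace V := ⊥
  have : DiscreteTopology V := ⟨rfl⟩
  change (Continuous fun x : G × V => V.ρ x.1 x.2) ↔ _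
  constructor
  · intro h x
    let K : Subgroup G :=
      { carrier := {g | V.ρ g x = x}
        mul_mem' := fun {a b} ha hb => by
          simp only [Set.mem_ofPred_eq] at ha hb ⊢
          rw [map_mul, Module.End.mul_apply, hb, ha]
        one_mem' := by simp
        inv_mem' := fun {a} ha => by
          simp only [Set.mem_ofPred_eq] at ha ⊢
          conv_lhs => rw [← ha]
          simp }
    refine ⟨K, ?_, fun g hg => hg⟩
    exact (isOpen_discrete {x}).preimage (h.comp (Continuous.prodMk_left x))
  · intro h
    refine continuous_iff_continuousAt.2 fun ⟨g, x⟩ => ?_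
    obtain ⟨K, hK, hfix⟩ := h x
    refine (continuousAt_const (y := V.ρ g x)).congr ?_
    have hU : IsOpen ({a : G | g⁻¹ * a ∈ K} ×ˢ ({x} : Set V)) :=
      (hK.preimage (continuous_const_mul g⁻¹)).prod (isOpen_discrete _)
    filter_upwards [hU.mem_nhds (by simp [K.one_mem])]
    rintro ⟨a, y⟩ ⟨ha, hy⟩
    obtain rfl : y = x := hy
    have := hfix _ ha
    conv_lhs => rw [← this]
    simp [← Module.End.mul_apply, ← map_mul]

lemma apply_mem_smoothPart (V : Rep.{w} k G) (g : G) :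
    smoothPart V ≤ (smoothPart V).comap (V.ρ g) := by
  refine iSup_le fun K x hx => ?_
  have hcoe : ((K.1.map (MulAut.conj g).toMonoidHom : Subgroup G) : Set G) =
      ((Homeomorph.mulLeft g).trans (Homeomorph.mulRight g⁻¹)) '' (K.1 : Set G) := by
    ext; simp
  have hc : IsCompact ((K.1.map (MulAut.conj g).toMonoidHom : Subgroup G) : Set G) := by
    rw [hcoe]; exact K.2.1.image (Homeomorph.continuous _)
  have ho : IsOpen ((K.1.map (MulAut.conj g).toMonoidHom : Subgroup G) : Set G) := by
    rw [hcoe]; exact (Homeomorph.isOpenMap _) _ K.2.2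
  refine (le_iSup (fun K : {K : Subgroup G // IsCompact (K : Set G) ∧ IsOpen (K : Set G)} =>
    fixedBy V K.1) ⟨_, hc, ho⟩) ?_
  refine mem_fixedBy.2 ?_
  rintro _ ⟨a, ha, rfl⟩
  have := mem_fixedBy.1 hx a ha
  conv_rhs => rw [← this]
  simp [← Module.End.mul_apply, ← map_mul]

/-- The smooth part as a subrepresentation. -/
noncomputable abbrev smoothPartRep (V : Rep.{w} k G) : Rep.{w} k G :=
  V.subrepresentation (smoothPart V) (apply_mem_smoothPart V)

lemma isSmooth_smoothPartRep (V : Rep.{w} k G) : IsSmooth k G (smoothPartRep V) := by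
  rw [isSmooth_iff]
  rintro ⟨x, hx⟩
  obtain ⟨K, hK, h⟩ := exists_isOpen_of_mem_smoothPart V hx
  exact ⟨K, hK, fun g hg => Subtype.ext (h g hg)⟩

/-- A morphism of representations restricts to the smooth parts. -/
noncomputable def smoothPartMap {V W : Rep.{w} k G} (f : V ⟶ W) : smoothPartRep V ⟶ smoothPartRep W :=
  Rep.ofHom
    { toLinearMap := f.hom.toLinearMap.restrict fun _ hx => map_mem_smoothPart f hx
      isIntertwining' := fun g => by
        ext x
        exact Rep.hom_comm_apply f g x.1 }

variable (k G)

/-- The smooth part functor `Rep k G ⥤ SmRep k G`. -/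
noncomputable def smoothFunctor : Rep.{w} k G ⥤ SmRep.{u, v, w} k G where
  obj V := ⟨smoothPartRep V, isSmooth_smoothPartRep V⟩
  map f := ObjectProperty.homMk (smoothPartMap f)
  map_id V := by ext; rfl
  map_comp f g := by ext; rfl

instance : (smoothFunctor.{u, v, w} k G).Additive where
  map_add := by intros; ext; rfl

/-! `SmRep k G` is abelian: smooth representations are stable under subobjects, quotients and
finite products. -/

instance : (IsSmooth.{u, v, w} k G).IsClosedUnderSubobjects where
  prop_of_mono {X Y} f _ hY := by
    rw [isSmooth_iff] at hY ⊢
    intro x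
    obtain ⟨K, hK, h⟩ := hY (f.hom x)
    refine ⟨K, hK, fun g hg => (Rep.mono_iff_injective f).1 inferInstance ?_⟩
    exact (Rep.hom_comm_apply f g x).trans (h g hg)

instance : (IsSmooth.{u, v, w} k G).IsClosedUnderQuotients where
  prop_of_epi {X Y} f _ hX := by
    rw [isSmooth_iff] at hX ⊢
    intro y
    obtain ⟨x, rfl⟩ := (Rep.epi_iff_surjective f).1 inferInstance y
    obtain ⟨K, hK, h⟩ := hX x
    refine ⟨K, hK, fun g hg => ?_⟩
    exact (Rep.hom_comm_apply f g x).symm.trans (congrArg f.hom (h g hg))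

instance : (IsSmooth.{u, v, w} k G).ContainsZero where
  exists_zero := ⟨Rep.trivial k G PUnit, (Rep.isZero_iff k G _).2 (inferInstanceAs (Subsingleton PUnit)), by
    rw [isSmooth_iff]
    exact fun x => ⟨⊤, by simp, fun g _ => rfl⟩⟩

instance : (IsSmooth.{u, v, w} k G).IsClosedUnderFiniteProducts := by
  have : (IsSmooth.{u, v, w} k G).IsClosedUnderBinaryProducts := by
    refine ⟨?_⟩
    rintro X ⟨P⟩
    let a : X ⟶ P.diag.obj ⟨.left⟩ := P.π.app ⟨.left⟩
    let b : X ⟶ P.diag.obj ⟨.right⟩ := P.π.app ⟨.right⟩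
    have hA := (isSmooth_iff _).1 (P.prop_diag_obj ⟨.left⟩)
    have hB := (isSmooth_iff _).1 (P.prop_diag_obj ⟨.right⟩)
    let f : X ⟶ P.diag.obj ⟨.left⟩ ⊞ P.diag.obj ⟨.right⟩ := biprod.lift a b
    have : Mono f := ⟨fun s t hst => P.isLimit.hom_ext <| by
      rintro ⟨_ | _⟩
      · simpa [f, a] using hst =≫ biprod.fst
      · simpa [f, b] using hst =≫ biprod.snd⟩
    have hf := (Rep.mono_iff_injective f).1 inferInstance
    rw [isSmooth_iff]
    intro x
    obtain ⟨K, hK, hx⟩ := hA (a.hom x)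
    obtain ⟨L, hL, hy⟩ := hB (b.hom x)
    refine ⟨K ⊓ L, by rw [Subgroup.coe_inf]; exact hK.inter hL, fun g hg => hf ?_⟩
    have key : ∀ z : X, f.hom z = (biprod.inl : _ ⟶ P.diag.obj ⟨.left⟩ ⊞ P.diag.obj ⟨.right⟩).hom
        (a.hom z) + (biprod.inr : _ ⟶ P.diag.obj ⟨.left⟩ ⊞ P.diag.obj ⟨.right⟩).hom
        (b.hom z) := by
      intro z
      have : f = a ≫ biprod.inl + b ≫ biprod.inr := biprod.lift_eq
      rw [this]
      rfl
    rw [key, key, Rep.hom_comm_apply a g x, Rep.hom_comm_apply b g x, hx g hg.1, hy g hg.2]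
  exact ObjectProperty.IsClosedUnderFiniteProducts.mk'

end SmoothRep

/-!
Let `V → I⁰ → I¹ → ⋯` be an injective resolution. The vanishing of `R¹ sm V` means that every
`y ∈ I⁰` with smooth image in `I¹` is smooth. For such a `y`, the vectors `g y - y` are smooth for
all `g` in an open subgroup. Replacing a small `g` by a power, we may assume that `g` fixes
`g y - y`; since the closure `C` of `⟨g⟩` is commutative and stabilizers of smooth vectors are
closed, every `x ∈ C` then fixes `x y - y`. Hence `x ^ m y = y + m (x y - y) = y` for
`m = char k`. So the stabilizer of `y` contains, for every procyclic subgroup in a compact open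
subgroup, the `n`-th powers of its elements for some `n > 0`.

In a `p`-adic analytic group this forces a subgroup to be open. Near `1`, a chart `φ` turns
multiplication into addition up to an error with Lipschitz constant `|p|²`, so that `φ (g ^ n)` is
`n φ(g)` up to a relative error `|p|`. Taking `g i` with `φ (g i)` proportional to the basis
vectors, successive approximation shows that the values of `φ` on ordered products of powers of the
`g i ^ n` are dense in a ball, and by compactness that the corresponding products of elements of
procyclic subgroups fill a neighbourhood of `1` (coordinates of the second kind).
-/

open scoped NNReal

section ProcyclicSubgroups

variable {G : Type*} [Group G] [TopologicalSpace G] [IsTopologicalGroup G]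

variable (G) in
/-- A topological group has this property if it has a compact open subgroup `K` such that a subgroup
of `G` is open as soon as it contains, for each `g ∈ K`, the `n`-th powers of the elements of the
procyclic group topologically generated by `g`, for some `n > 0` which may depend on `g`. -/
def ProcyclicSubgroupsDetectOpen : Prop :=
  ∃ K : Subgroup G, IsCompact (K : Set G) ∧ IsOpen (K : Set G) ∧
    ∀ H : Subgroup G, (∀ g ∈ K, ∃ n, 0 < n ∧
      ∀ x ∈ (Subgroup.zpowers g).topologicalClosure, x ^ n ∈ H) → IsOpen (H : Set G)

lemma exists_pow_mem_of_isCompact_of_isOpen {K U : Subgroup G} (hK : IsCompact (K : Set G))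
    (hU : IsOpen (U : Set G)) {g : G} (hg : g ∈ K) : ∃ n, 0 < n ∧ g ^ n ∈ U := by
  have : CompactSpace K := isCompact_iff_compactSpace.1 hK
  have : Finite (K ⧸ U.subgroupOf K) :=
    Subgroup.quotient_finite_of_isOpen _ (hU.preimage continuous_subtype_val)
  obtain ⟨n, hn, -, h⟩ := Subgroup.exists_pow_mem_of_relIndex_ne_zero (H := U) (K := K)
    Subgroup.index_ne_zero_of_finite hg
  exact ⟨n, hn, h.1⟩

lemma pow_mem_topologicalClosure_zpowers_pow {g x : G}
    (hx : x ∈ (Subgroup.zpowers g).topologicalClosure) (n : ℕ) :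
    x ^ n ∈ (Subgroup.zpowers (g ^ n)).topologicalClosure := by
  refine map_mem_closure (f := (· ^ n)) (continuous_pow n) hx ?_
  rintro _ ⟨a, rfl⟩
  exact ⟨a, by simp only [← zpow_natCast, ← zpow_mul, mul_comm]⟩

lemma commute_of_mem_topologicalClosure_zpowers [T2Space G] {g x : G}
    (hx : x ∈ (Subgroup.zpowers g).topologicalClosure) : Commute g x := by
  have hle : (Subgroup.zpowers g).topologicalClosure ≤ Subgroup.centralizer {g} :=
    Subgroup.topologicalClosure_minimal _
      (Subgroup.zpowers_le.2 (Subgroup.mem_centralizer_singleton_iff.2 rfl))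
      (Set.isClosed_centralizer _)
  exact (Subgroup.mem_centralizer_singleton_iff.1 (hle hx)).symm

end ProcyclicSubgroups

namespace SmoothRep

section SmoothVectors

variable {R : Type*} [Ring R] {G : Type*} [Group G] {W : Type*} [AddCommGroup W] [Module R W]

/-- The stabilizer of a vector `y` in a representation. -/
def vectorStabilizer (ρ : Representation R G W) (y : W) : Subgroup G :=
  (MulAction.stabilizer (Module.End R W)ˣ y).comap (MonoidHom.toHomUnits ρ)

variable {ρ : Representation R G W} {y : W}

lemma mem_vectorStabilizer {g : G} : g ∈ vectorStabilizer ρ y ↔ ρ g y = y := Iff.rfl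

lemma mem_vectorStabilizer_sub_of_commute {a b : G} (hab : Commute a b)
    (h : b ∈ vectorStabilizer ρ (ρ a y - y)) : a ∈ vectorStabilizer ρ (ρ b y - y) := by
  rw [mem_vectorStabilizer, map_sub, ← Module.End.mul_apply, ← map_mul] at h ⊢
  rw [hab.eq]
  linear_combination (norm := abel) h

lemma pow_apply_eq_add_nsmul {x : G} (h : x ∈ vectorStabilizer ρ (ρ x y - y)) (n : ℕ) :
    ρ (x ^ n) y = y + n • (ρ x y - y) := by
  induction n with
  | zero => simp
  | succ n ih =>
    have hn : ρ (x ^ n) (ρ x y - y) = ρ x y - y := pow_mem h n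
    rw [map_sub, ih, sub_eq_iff_eq_add] at hn
    rw [pow_succ, map_mul, Module.End.mul_apply, hn, succ_nsmul]
    abel

variable [TopologicalSpace G]

/-- A vector of a representation is smooth if its stabilizer is open. -/
def IsSmoothVector (ρ : Representation R G W) (y : W) : Prop :=
  IsOpen (vectorStabilizer ρ y : Set G)

lemma IsSmoothVector.of_le [SeparatelyContinuousMul G] (hy : IsSmoothVector ρ y) {W' : Type*}
    [AddCommGroup W'] [Module R W'] {ρ' : Representation R G W'} {y' : W'}
    (h : vectorStabilizer ρ y ≤ vectorStabilizer ρ' y') : IsSmoothVector ρ' y' :=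
  Subgroup.isOpen_mono h hy

variable [IsTopologicalGroup G]

lemma IsSmoothVector.topologicalClosure_zpowers_le (hy : IsSmoothVector ρ y) {g : G}
    (hg : g ∈ vectorStabilizer ρ y) :
    (Subgroup.zpowers g).topologicalClosure ≤ vectorStabilizer ρ y :=
  Subgroup.topologicalClosure_minimal _ (Subgroup.zpowers_le.2 hg)
    (Subgroup.isClosed_of_isOpen _ hy)

variable [T2Space G] {N : Subgroup G}

lemma mem_vectorStabilizer_sub_of_mem_topologicalClosure (hN : IsOpen (N : Set G))
    (hsm : ∀ g ∈ N, IsSmoothVector ρ (ρ g y - y)) {g : G} (hgN : g ∈ N)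
    (hg : g ∈ vectorStabilizer ρ (ρ g y - y)) {x : G}
    (hx : x ∈ (Subgroup.zpowers g).topologicalClosure) :
    x ∈ vectorStabilizer ρ (ρ x y - y) := by
  have hxN : x ∈ N := Subgroup.topologicalClosure_minimal _ (Subgroup.zpowers_le.2 hgN)
    (N.isClosed_of_isOpen hN) hx
  have hgx : g ∈ vectorStabilizer ρ (ρ x y - y) :=
    mem_vectorStabilizer_sub_of_commute (commute_of_mem_topologicalClosure_zpowers hx)
      ((hsm g hgN).topologicalClosure_zpowers_le hg hx)
  exact (hsm x hxN).topologicalClosure_zpowers_le hgx hx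

theorem exists_forall_pow_mem_vectorStabilizer {m : ℕ} (hm : 0 < m) (hmR : (m : R) = 0)
    (hN : IsOpen (N : Set G)) (hsm : ∀ g ∈ N, IsSmoothVector ρ (ρ g y - y))
    {K : Subgroup G} (hK : IsCompact (K : Set G)) {g : G} (hg : g ∈ K) :
    ∃ n, 0 < n ∧ ∀ x ∈ (Subgroup.zpowers g).topologicalClosure,
      x ^ n ∈ vectorStabilizer ρ y := by
  obtain ⟨i, hi, hiN⟩ := exists_pow_mem_of_isCompact_of_isOpen hK hN hg
  obtain ⟨j, hj, hjstab⟩ :=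
    exists_pow_mem_of_isCompact_of_isOpen hK (hsm _ hiN) (K.pow_mem hg i)
  have hself : (g ^ i) ^ j ∈ vectorStabilizer ρ (ρ ((g ^ i) ^ j) y - y) :=
    pow_mem (mem_vectorStabilizer_sub_of_commute ((Commute.refl (g ^ i)).pow_right j) hjstab) j
  refine ⟨i * j * m, by positivity, fun x hx => ?_⟩
  have hfix : x ^ (i * j) ∈ vectorStabilizer ρ (ρ (x ^ (i * j)) y - y) := by
    refine mem_vectorStabilizer_sub_of_mem_topologicalClosure hN hsm (N.pow_mem hiN j) hself ?_
    rw [← pow_mul]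
    exact pow_mem_topologicalClosure_zpowers_pow hx (i * j)
  rw [mem_vectorStabilizer, pow_mul, pow_apply_eq_add_nsmul hfix, ← Nat.cast_smul_eq_nsmul R, hmR,
    zero_smul, add_zero]

theorem isSmoothVector_of_isSmoothVector_sub (hG : ProcyclicSubgroupsDetectOpen G) {m : ℕ}
    (hm : 0 < m) (hmR : (m : R) = 0) (hN : IsOpen (N : Set G))
    (hsm : ∀ g ∈ N, IsSmoothVector ρ (ρ g y - y)) : IsSmoothVector ρ y := by
  obtain ⟨K, hK, -, hdetect⟩ := hG
  exact hdetect _ fun g hg => exists_forall_pow_mem_vectorStabilizer hm hmR hN hsm hK hg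

end SmoothVectors

end SmoothRep

section AlmostAdditive

variable {G E : Type*} [Group G] [NormedAddCommGroup E]

/-- A map `φ` from a group to a normed group is almost additive on `S`, with error `c`, if it
vanishes at `1` and `φ (g * h)` differs from `φ g + φ h`, for `g, h ∈ S`, by a function of
`(φ g, φ h)` with Lipschitz constant `c`. It is meant for charts of analytic groups. -/
structure IsAlmostAdditiveOn (c : ℝ≥0) (φ : G → E) (S : Set G) : Prop where
  map_one : φ 1 = 0
  norm_map_mul_sub_le : ∀ g ∈ S, ∀ h ∈ S, ∀ g' ∈ S, ∀ h' ∈ S,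
    ‖φ (g * h) - φ (g' * h') - ((φ g - φ g') + (φ h - φ h'))‖ ≤
      c * max ‖φ g - φ g'‖ ‖φ h - φ h'‖

lemma norm_add_le_of_le_of_le [IsUltrametricDist E] {a b : E} {M : ℝ} (ha : ‖a‖ ≤ M)
    (hb : ‖b‖ ≤ M) : ‖a + b‖ ≤ M :=
  (IsUltrametricDist.norm_add_le_max a b).trans (max_le ha hb)

lemma norm_le_of_norm_sub_le_mul [IsUltrametricDist E] {c : ℝ≥0} (hc : c ≤ 1) {a b : E} {M : ℝ}
    (hb : ‖b‖ ≤ M) (hab : ‖a - b‖ ≤ c * M) : ‖a‖ ≤ M := by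
  rw [← sub_add_cancel a b]
  exact norm_add_le_of_le_of_le
    (hab.trans (mul_le_of_le_one_left ((norm_nonneg b).trans hb) hc)) hb

namespace IsAlmostAdditiveOn

variable {φ : G → E} {c : ℝ≥0}

lemma mono {c' : ℝ≥0} {S S' : Set G} (h : IsAlmostAdditiveOn c φ S) (hS : S' ⊆ S) (hc : c ≤ c') :
    IsAlmostAdditiveOn c' φ S' where
  map_one := h.map_one
  norm_map_mul_sub_le g hg k hk g' hg' k' hk' :=
    (h.norm_map_mul_sub_le g (hS hg) k (hS hk) g' (hS hg') k' (hS hk')).trans (by gcongr)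

variable [IsUltrametricDist E]

lemma norm_map_mul_sub_sub_le {S : Set G} (h : IsAlmostAdditiveOn c φ S) (hc : c ≤ 1)
    {g k g' k' : G} (hg : g ∈ S) (hk : k ∈ S) (hg' : g' ∈ S) (hk' : k' ∈ S) {u v : E} {M : ℝ}
    (hu : ‖u‖ ≤ M) (hv : ‖v‖ ≤ M) (hgu : ‖φ g - φ g' - u‖ ≤ c * M)
    (hkv : ‖φ k - φ k' - v‖ ≤ c * M) : ‖φ (g * k) - φ (g' * k') - (u + v)‖ ≤ c * M := by
  have hmul : ‖φ (g * k) - φ (g' * k') - ((φ g - φ g') + (φ k - φ k'))‖ ≤ c * M := by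
    refine (h.norm_map_mul_sub_le g hg k hk g' hg' k' hk').trans ?_
    gcongr
    exact max_le (norm_le_of_norm_sub_le_mul hc hu hgu) (norm_le_of_norm_sub_le_mul hc hv hkv)
  convert norm_add_le_of_le_of_le hmul (norm_add_le_of_le_of_le hgu hkv) using 2
  abel

variable {K : Subgroup G}

lemma norm_map_pow_sub_nsmul_le (h : IsAlmostAdditiveOn c φ K) (hc : c ≤ 1) {g : G} (hg : g ∈ K)
    (n : ℕ) : ‖φ (g ^ n) - n • φ g‖ ≤ c * ‖φ g‖ := by
  induction n with
  | zero => simpa [h.map_one] using by positivity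
  | succ n ih =>
    rw [pow_succ, succ_nsmul]
    simpa [h.map_one] using h.norm_map_mul_sub_sub_le hc (K.pow_mem hg n) hg K.one_mem K.one_mem
      (IsUltrametricDist.norm_nsmul_le (φ g) n) le_rfl (by simpa [h.map_one] using ih)
      (by simpa [h.map_one] using by positivity)

lemma norm_map_list_prod_sub_le (h : IsAlmostAdditiveOn c φ K) (hc : c ≤ 1) {ι : Type*}
    {x x' : ι → G} (hx : ∀ i, x i ∈ K) (hx' : ∀ i, x' i ∈ K) {u : ι → E} {M : ℝ} (hM : 0 ≤ M)
    (hu : ∀ i, ‖u i‖ ≤ M) (hxu : ∀ i, ‖φ (x i) - φ (x' i) - u i‖ ≤ c * M) (l : List ι) :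
    ‖φ (l.map x).prod - φ (l.map x').prod - (l.map u).sum‖ ≤ c * M := by
  have hmem : ∀ {z : ι → G}, (∀ i, z i ∈ K) → ∀ l : List ι, (l.map z).prod ∈ K := fun hz l =>
    list_prod_mem (by simpa using fun i _ => hz i)
  have hsum : ∀ l : List ι, ‖(l.map u).sum‖ ≤ M := fun l => by
    induction l with
    | nil => simpa using hM
    | cons i l ih => simpa using norm_add_le_of_le_of_le (hu i) ih
  induction l with
  | nil => simpa using by positivity
  | cons i l ih =>
    simpa using h.norm_map_mul_sub_sub_le hc (hx i) (hmem hx l) (hx' i) (hmem hx' l) (hu i)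
      (hsum l) (hxu i) ih

end IsAlmostAdditiveOn

end AlmostAdditive

section Padic

variable {p : ℕ} [Fact p.Prime]

lemma nnnorm_natCast_p_le_one : ‖(p : ℚ_[p])‖₊ ≤ 1 := Padic.norm_p_lt_one.le

namespace IsAlmostAdditiveOn

variable {G E : Type*} [Group G] [NormedAddCommGroup E] [NormedSpace ℚ_[p] E]
  [IsUltrametricDist E] {φ : G → E} {K : Subgroup G}

lemma norm_map_pow_sub_smul_le (h : IsAlmostAdditiveOn (‖(p : ℚ_[p])‖₊ ^ 2) φ K) {g : G}
    (hg : g ∈ K) (n : ℕ) :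
    ‖φ (g ^ n) - (n : ℚ_[p]) • φ g‖ ≤ ‖(p : ℚ_[p])‖ * ‖(n : ℚ_[p]) • φ g‖ := by
  induction n using Nat.recOnMul generalizing g with
  | zero => simp [h.map_one]
  | one => simpa using by positivity
  | prime q hq =>
    have hpow : ‖φ (g ^ q) - (q : ℚ_[p]) • φ g‖ ≤ ‖(p : ℚ_[p])‖ * (‖(p : ℚ_[p])‖ * ‖φ g‖) := by
      simpa [pow_two, mul_assoc, Nat.cast_smul_eq_nsmul] using
        h.norm_map_pow_sub_nsmul_le (pow_le_one₀ zero_le nnnorm_natCast_p_le_one) hg q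
    have hpq : ‖(p : ℚ_[p])‖ ≤ ‖(q : ℚ_[p])‖ := by
      rcases eq_or_ne p q with rfl | hne
      · rfl
      · rw [Padic.norm_natCast_eq_one_iff.2 ((Nat.coprime_primes Fact.out hq).2 hne)]
        exact Padic.norm_p_lt_one.le
    refine hpow.trans ?_
    rw [norm_smul]
    gcongr
  | mul a b iha ihb =>
    have ha : ‖φ (g ^ a)‖ ≤ ‖(a : ℚ_[p]) • φ g‖ :=
      norm_le_of_norm_sub_le_mul nnnorm_natCast_p_le_one le_rfl (iha hg)
    have hb : ‖φ ((g ^ a) ^ b) - (b : ℚ_[p]) • φ (g ^ a)‖ ≤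
        ‖(p : ℚ_[p])‖ * (‖(b : ℚ_[p])‖ * ‖(a : ℚ_[p]) • φ g‖) := by
      refine (ihb (K.pow_mem hg a)).trans ?_
      rw [norm_smul]
      gcongr
    have hab : ‖(b : ℚ_[p]) • (φ (g ^ a) - (a : ℚ_[p]) • φ g)‖ ≤
        ‖(p : ℚ_[p])‖ * (‖(b : ℚ_[p])‖ * ‖(a : ℚ_[p]) • φ g‖) := by
      rw [norm_smul, mul_left_comm]
      gcongr
      exact iha hg
    have hsplit : φ (g ^ (a * b)) - ((a * b : ℕ) : ℚ_[p]) • φ g =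
        (φ ((g ^ a) ^ b) - (b : ℚ_[p]) • φ (g ^ a)) +
          (b : ℚ_[p]) • (φ (g ^ a) - (a : ℚ_[p]) • φ g) := by
      rw [pow_mul]
      push_cast
      module
    rw [hsplit, Nat.cast_mul, mul_comm (a : ℚ_[p]), mul_smul, norm_smul (b : ℚ_[p])]
    exact norm_add_le_of_le_of_le hb hab

lemma norm_map_pow_add_sub_smul_le (h : IsAlmostAdditiveOn (‖(p : ℚ_[p])‖₊ ^ 2) φ K) {g : G}
    (hg : g ∈ K) {v : E} (hv : ‖φ g - v‖ ≤ ‖(p : ℚ_[p])‖ * ‖v‖) (a b : ℕ) :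
    ‖φ (g ^ (a + b)) - φ (g ^ a) - (b : ℚ_[p]) • v‖ ≤ ‖(p : ℚ_[p])‖ * ‖(b : ℚ_[p]) • v‖ := by
  have h' : IsAlmostAdditiveOn ‖(p : ℚ_[p])‖₊ φ K :=
    h.mono subset_rfl (pow_le_of_le_one zero_le nnnorm_natCast_p_le_one two_ne_zero)
  have hφv : ‖φ g‖ ≤ ‖v‖ := norm_le_of_norm_sub_le_mul nnnorm_natCast_p_le_one le_rfl hv
  have hpow : ‖φ (g ^ b) - (b : ℚ_[p]) • v‖ ≤ ‖(p : ℚ_[p])‖ * ‖(b : ℚ_[p]) • v‖ := by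
    rw [← sub_add_sub_cancel _ ((b : ℚ_[p]) • φ g), ← smul_sub]
    refine norm_add_le_of_le_of_le ((h.norm_map_pow_sub_smul_le hg b).trans ?_) ?_
    · rw [norm_smul, norm_smul]
      gcongr
    · rw [norm_smul, norm_smul, mul_left_comm]
      gcongr
  simpa [pow_add] using h'.norm_map_mul_sub_sub_le nnnorm_natCast_p_le_one (K.pow_mem hg a)
    (K.pow_mem hg b) (K.pow_mem hg a) K.one_mem (u := 0) (by simp) le_rfl
    (by simpa using by positivity) (by simpa [h.map_one] using hpow)

end IsAlmostAdditiveOn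

lemma exists_nat_norm_sub_le {x : ℚ_[p]} (hx : ‖x‖ ≤ 1) {ε : ℝ} (hε : 0 < ε) :
    ∃ b : ℕ, ‖x - b‖ ≤ ε := by
  obtain ⟨b, hb⟩ := (PadicInt.denseRange_natCast (p := p)).exists_dist_lt (⟨x, hx⟩ : ℤ_[p]) hε
  exact ⟨b, (dist_eq_norm x b).symm.trans_le hb.le⟩

section Approximation

variable {ι : Type*} [Fintype ι] {Ψ : (ι → ℕ) → ι → ℚ_[p]} {c : ℚ_[p]}

lemma exists_norm_sub_le_pow_succ
    (hΨ : ∀ a b : ι → ℕ, ‖Ψ (a + b) - Ψ a - c • fun i => (b i : ℚ_[p])‖ ≤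
      ‖(p : ℚ_[p])‖ * ‖c • fun i => (b i : ℚ_[p])‖) (hc : c ≠ 0) {y : ι → ℚ_[p]} {n : ℕ}
    {a : ι → ℕ} (ha : ‖y - Ψ a‖ ≤ ‖(p : ℚ_[p])‖ ^ n * ‖c‖) :
    ∃ b, ‖y - Ψ (a + b)‖ ≤ ‖(p : ℚ_[p])‖ ^ (n + 1) * ‖c‖ := by
  set π : ℝ := ‖(p : ℚ_[p])‖
  have hπ : 0 < π := norm_pos_iff.2 (Nat.cast_ne_zero.2 (Fact.out : p.Prime).ne_zero)
  have hπ₁ : π < 1 := Padic.norm_p_lt_one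
  have hx : ‖c⁻¹ • (y - Ψ a)‖ ≤ π ^ n := by
    rwa [norm_smul, norm_inv, inv_mul_le_iff₀ (norm_pos_iff.2 hc), mul_comm]
  choose b hb using fun i => exists_nat_norm_sub_le
    ((norm_le_pi_norm _ i).trans (hx.trans (pow_le_one₀ hπ.le hπ₁.le))) (pow_pos hπ (n + 1))
  have hxb : ‖c⁻¹ • (y - Ψ a) - fun i => (b i : ℚ_[p])‖ ≤ π ^ (n + 1) :=
    (pi_norm_le_iff_of_nonneg (by positivity)).2 hb
  have hres : ‖y - Ψ a - c • fun i => (b i : ℚ_[p])‖ ≤ π ^ (n + 1) * ‖c‖ := by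
    rw [← smul_inv_smul₀ hc (y - Ψ a), ← smul_sub, norm_smul, mul_comm]
    gcongr
  have hb' : ‖c • fun i => (b i : ℚ_[p])‖ ≤ π ^ n * ‖c‖ := by
    rw [← neg_sub, norm_neg, pow_succ', mul_assoc] at hres
    exact norm_le_of_norm_sub_le_mul nnnorm_natCast_p_le_one ha hres
  have herr : ‖Ψ (a + b) - Ψ a - c • fun i => (b i : ℚ_[p])‖ ≤ π ^ (n + 1) * ‖c‖ := by
    rw [pow_succ', mul_assoc]
    exact (hΨ a b).trans (by gcongr)
  rw [← norm_neg] at herr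
  exact ⟨b, by simpa using norm_add_le_of_le_of_le hres herr⟩

lemma mem_closure_range_of_norm_sub_le (hΨ₀ : Ψ 0 = 0)
    (hΨ : ∀ a b : ι → ℕ, ‖Ψ (a + b) - Ψ a - c • fun i => (b i : ℚ_[p])‖ ≤
      ‖(p : ℚ_[p])‖ * ‖c • fun i => (b i : ℚ_[p])‖) (hc : c ≠ 0) {y : ι → ℚ_[p]}
    (hy : ‖y‖ ≤ ‖c‖) : y ∈ closure (Set.range Ψ) := by
  have hex : ∀ n, ∃ a, ‖y - Ψ a‖ ≤ ‖(p : ℚ_[p])‖ ^ n * ‖c‖ := by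
    intro n
    induction n with
    | zero => exact ⟨0, by simpa [hΨ₀] using hy⟩
    | succ n ih =>
      obtain ⟨a, ha⟩ := ih
      obtain ⟨b, hb⟩ := exists_norm_sub_le_pow_succ hΨ hc ha
      exact ⟨a + b, hb⟩
  choose a ha using hex
  refine mem_closure_of_tendsto (f := fun n => Ψ (a n)) (b := Filter.atTop) ?_
    (.of_forall fun n => ⟨a n, rfl⟩)
  have hlim : Filter.Tendsto (fun n : ℕ => ‖(p : ℚ_[p])‖ ^ n * ‖c‖) Filter.atTop (nhds 0) := by
    simpa using (tendsto_pow_atTop_nhds_zero_of_lt_one (norm_nonneg _)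
      (Padic.norm_p_lt_one (p := p))).mul_const ‖c‖
  refine tendsto_iff_norm_sub_tendsto_zero.2
    (squeeze_zero (fun _ => norm_nonneg _) (fun n => ?_) hlim)
  rw [norm_sub_rev]
  exact ha n

end Approximation

namespace IsAlmostAdditiveOn

variable {G : Type*} [Group G] {d : ℕ} {φ : G → Fin d → ℚ_[p]} {K : Subgroup G}

lemma mem_closure_range_map_prod_pow (h : IsAlmostAdditiveOn (‖(p : ℚ_[p])‖₊ ^ 2) φ K)
    {γ : Fin d → G} (hγK : ∀ i, γ i ∈ K) {c : ℚ_[p]} (hc : c ≠ 0)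
    (hγ : ∀ i, ‖φ (γ i) - Pi.single i c‖ ≤ ‖(p : ℚ_[p])‖ * ‖c‖) {y : Fin d → ℚ_[p]}
    (hy : ‖y‖ ≤ ‖c‖) :
    y ∈ closure (Set.range fun a : Fin d → ℕ =>
      φ ((List.finRange d).map fun i => γ i ^ a i).prod) := by
  have h' : IsAlmostAdditiveOn ‖(p : ℚ_[p])‖₊ φ K :=
    h.mono subset_rfl (pow_le_of_le_one zero_le nnnorm_natCast_p_le_one two_ne_zero)
  refine mem_closure_range_of_norm_sub_le (by simp [h.map_one]) (fun a b => ?_) hc hy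
  have hbound : ∀ i, ‖(b i : ℚ_[p]) • (Pi.single i c : Fin d → ℚ_[p])‖ ≤
      ‖c • fun i => (b i : ℚ_[p])‖ := fun i => by
    rw [norm_smul, Pi.norm_single, mul_comm, ← norm_mul]
    exact norm_le_pi_norm (c • fun i => (b i : ℚ_[p])) i
  have hfactor : ∀ i, ‖φ (γ i ^ (a i + b i)) - φ (γ i ^ a i) - (b i : ℚ_[p]) • Pi.single i c‖ ≤
      ‖(p : ℚ_[p])‖ * ‖c • fun i => (b i : ℚ_[p])‖ := fun i =>
    (h.norm_map_pow_add_sub_smul_le (hγK i) (by rw [Pi.norm_single]; exact hγ i) _ _).trans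
      (by gcongr; exact hbound i)
  have hsum : ((List.finRange d).map fun i =>
      (b i : ℚ_[p]) • (Pi.single i c : Fin d → ℚ_[p])).sum = c • fun i => (b i : ℚ_[p]) := by
    simp_rw [← Pi.single_smul, ← Fin.sum_univ_def]
    rw [Finset.univ_sum_single fun i => (b i : ℚ_[p]) • c]
    ext i
    exact mul_comm _ _
  have hprod := h'.norm_map_list_prod_sub_le nnnorm_natCast_p_le_one
    (fun i => K.pow_mem (hγK i) (a i + b i)) (fun i => K.pow_mem (hγK i) (a i)) (norm_nonneg _)
    hbound hfactor (List.finRange d)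
  rwa [hsum] at hprod

variable [TopologicalSpace G] [IsTopologicalGroup G]

lemma mem_of_forall_pow_mem (h : IsAlmostAdditiveOn (‖(p : ℚ_[p])‖₊ ^ 2) φ K)
    (hK : IsCompact (K : Set G)) (hK' : IsClosed (K : Set G)) (hcont : ContinuousOn φ K)
    (hinj : Set.InjOn φ K) {g : Fin d → G} (hg : ∀ i, g i ∈ K) {n : ℕ} {c : ℚ_[p]} (hc : c ≠ 0)
    (hgc : ∀ i, ‖φ (g i ^ n) - Pi.single i c‖ ≤ ‖(p : ℚ_[p])‖ * ‖c‖) {H : Subgroup G}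
    (hH : ∀ i, ∀ x ∈ (Subgroup.zpowers (g i)).topologicalClosure, x ^ n ∈ H) {x : G}
    (hx : x ∈ K) (hxc : ‖φ x‖ ≤ ‖c‖) : x ∈ H := by
  let C (i : Fin d) : Subgroup G := (Subgroup.zpowers (g i)).topologicalClosure
  let F (z : Fin d → G) : G := ((List.finRange d).map fun i => z i ^ n).prod
  have hCK : ∀ i, C i ≤ K := fun i =>
    Subgroup.topologicalClosure_minimal _ (Subgroup.zpowers_le.2 (hg i)) hK'
  have hC : IsCompact (Set.univ.pi fun i => (C i : Set G)) := isCompact_univ_pi fun i =>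
    hK.of_isClosed_subset (Subgroup.isClosed_topologicalClosure _) (hCK i)
  have hF : Continuous F := continuous_list_prod _ fun i _ => (continuous_apply i).pow n
  have hmem : ∀ {L : Subgroup G}, (∀ i, ∀ x ∈ C i, x ^ n ∈ L) →
      Set.MapsTo F (Set.univ.pi fun i => (C i : Set G)) L := fun hL z hz =>
    list_prod_mem (by simpa using fun i => hL i _ (hz i trivial))
  have hFK := hmem fun i x hx => K.pow_mem (hCK i hx) n
  have hclosed : IsClosed ((φ ∘ F) '' Set.univ.pi fun i => (C i : Set G)) :=
    (hC.image_of_continuousOn (hcont.comp hF.continuousOn hFK)).isClosed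
  have hdense := h.mem_closure_range_map_prod_pow (fun i => K.pow_mem (hg i) n) hc hgc hxc
  obtain ⟨z, hz, hzx⟩ := closure_minimal (by
    rintro _ ⟨a, rfl⟩
    refine ⟨fun i => g i ^ a i, fun i _ =>
      Subgroup.le_topologicalClosure _ (Subgroup.pow_mem _ (Subgroup.mem_zpowers _) _), ?_⟩
    simp only [F, Function.comp_apply, pow_right_comm]) hclosed hdense
  rw [← hinj (hFK hz) hx hzx]
  exact hmem hH hz

theorem isOpen_of_forall_exists_pow_mem (h : IsAlmostAdditiveOn (‖(p : ℚ_[p])‖₊ ^ 2) φ K)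
    (hK : IsCompact (K : Set G)) (hK' : IsOpen (K : Set G)) (hcont : ContinuousOn φ K)
    (hinj : Set.InjOn φ K) (hφK : φ '' K ∈ nhds 0) {H : Subgroup G}
    (hH : ∀ g ∈ K, ∃ n, 0 < n ∧
      ∀ x ∈ (Subgroup.zpowers g).topologicalClosure, x ^ n ∈ H) : IsOpen (H : Set G) := by
  have hsingle : ∀ᶠ s : ℕ in Filter.atTop, ∀ i : Fin d,
      (Pi.single i ((p : ℚ_[p]) ^ s) : Fin d → ℚ_[p]) ∈ φ '' K :=
    Filter.eventually_all.2 fun i =>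
      (((continuous_single i).tendsto' 0 0 (Pi.single_zero i)).comp
        (tendsto_pow_atTop_nhds_zero_of_norm_lt_one Padic.norm_p_lt_one)).eventually_mem hφK
  obtain ⟨s, hs⟩ := hsingle.exists
  choose g hgK hg using hs
  choose n hn hnH using fun i => hH (g i) (hgK i)
  let N := ∏ i, n i
  let c : ℚ_[p] := N * p ^ s
  have hc : c ≠ 0 := mul_ne_zero (Nat.cast_ne_zero.2 (Finset.prod_pos fun i _ => hn i).ne')
    (pow_ne_zero _ (Nat.cast_ne_zero.2 (Fact.out : p.Prime).ne_zero))
  have hgc : ∀ i, ‖φ (g i ^ N) - Pi.single i c‖ ≤ ‖(p : ℚ_[p])‖ * ‖c‖ := fun i => by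
    have hsmul : (N : ℚ_[p]) • φ (g i) = Pi.single i c := by
      rw [hg, ← Pi.single_smul, smul_eq_mul]
    simpa [hsmul, Pi.norm_single] using h.norm_map_pow_sub_smul_le (hgK i) N
  have hNH : ∀ i, ∀ x ∈ (Subgroup.zpowers (g i)).topologicalClosure, x ^ N ∈ H := fun i x hx => by
    obtain ⟨q, hq⟩ := Finset.dvd_prod_of_mem n (Finset.mem_univ i)
    rw [show N = n i * q from hq, pow_mul]
    exact H.pow_mem (hnH i x hx) q
  have hK₁ : (K : Set G) ∈ nhds 1 := hK'.mem_nhds K.one_mem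
  have hsmall : ∀ᶠ x in nhds (1 : G), ‖φ x‖ < ‖c‖ :=
    (hcont.continuousAt hK₁).norm.eventually_lt_const (by simpa [h.map_one] using hc)
  refine H.isOpen_of_mem_nhds (g := 1) ?_
  filter_upwards [hK₁, hsmall] with x hx hxc
  exact h.mem_of_forall_pow_mem hK (K.isClosed_of_isOpen hK') hcont hinj hgK hc hgc hNH hx hxc.le

end IsAlmostAdditiveOn

end Padic

section Chart

lemma eq_fst_add_snd_of_hasFDerivAt {𝕜 E : Type*} [NontriviallyNormedField 𝕜]
    [NormedAddCommGroup E] [NormedSpace 𝕜 E] {F : E × E → E} {L : E × E →L[𝕜] E} {a b : E}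
    (hF : HasFDerivAt F L (a, b)) (hl : (fun x => F (x, b)) =ᶠ[nhds a] id)
    (hr : (fun y => F (a, y)) =ᶠ[nhds b] id) :
    L = ContinuousLinearMap.fst 𝕜 E E + ContinuousLinearMap.snd 𝕜 E E := by
  have hinl : L.comp (ContinuousLinearMap.inl 𝕜 E E) = ContinuousLinearMap.id 𝕜 E :=
    (hF.comp a (hasFDerivAt_prodMk_left a b)).unique ((hasFDerivAt_id a).congr_of_eventuallyEq hl)
  have hinr : L.comp (ContinuousLinearMap.inr 𝕜 E E) = ContinuousLinearMap.id 𝕜 E :=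
    (hF.comp b (hasFDerivAt_prodMk_right a b)).unique ((hasFDerivAt_id b).congr_of_eventuallyEq hr)
  rw [← L.coprod_comp_inl_inr, hinl, hinr]
  ext <;> simp

variable {𝕜 E G : Type*} [NontriviallyNormedField 𝕜] [NormedAddCommGroup E] [NormedSpace 𝕜 E]
  [Group G] [TopologicalSpace G] [ChartedSpace E G]

variable (E G) in
/-- The multiplication of an analytic group, read in the preferred chart at `1`. -/
noncomputable def chartMul (z : E × E) : E :=
  chartAt E (1 : G) ((chartAt E (1 : G)).symm z.1 * (chartAt E (1 : G)).symm z.2)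

variable (𝕜 E G) in
lemma analyticAt_chartMul [LieGroup 𝓘(𝕜, E) ω G] :
    AnalyticAt 𝕜 (chartMul E G) (chartAt E (1 : G) 1, chartAt E (1 : G) 1) := by
  set e := chartAt E (1 : G)
  have h1 : (1 : G) ∈ e.source := mem_chart_source _ _
  have hsymm : ContMDiffAt 𝓘(𝕜, E) 𝓘(𝕜, E) ω e.symm (e 1) :=
    contMDiffOn_chart_symm.contMDiffAt (e.open_target.mem_nhds (e.map_source h1))
  have hmul : ContMDiffAt 𝓘(𝕜, E × E) 𝓘(𝕜, E) ω
      (fun z : E × E => e.symm z.1 * e.symm z.2) (e 1, e 1) :=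
    (hsymm.comp (e 1, e 1) contDiff_fst.contDiffAt.contMDiffAt).mul
      (hsymm.comp (e 1, e 1) contDiff_snd.contDiffAt.contMDiffAt)
  have hchart : ContMDiffAt 𝓘(𝕜, E) 𝓘(𝕜, E) ω e (e.symm (e 1) * e.symm (e 1)) := by
    rw [e.left_inv h1, one_mul]
    exact contMDiffOn_chart.contMDiffAt (e.open_source.mem_nhds h1)
  exact (hchart.comp (e 1, e 1) hmul).contDiffAt.analyticAt

variable (𝕜 E G) in
lemma hasStrictFDerivAt_chartMul [LieGroup 𝓘(𝕜, E) ω G] :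
    HasStrictFDerivAt (chartMul E G)
      (ContinuousLinearMap.fst 𝕜 E E + ContinuousLinearMap.snd 𝕜 E E)
      (chartAt E (1 : G) 1, chartAt E (1 : G) 1) := by
  set e := chartAt E (1 : G) with he
  have h1 : (1 : G) ∈ e.source := mem_chart_source _ _
  have hderiv := (analyticAt_chartMul 𝕜 E G).hasStrictFDerivAt
  have hmem : ∀ᶠ x in nhds (e 1), x ∈ e.target := e.open_target.mem_nhds (e.map_source h1)
  rwa [eq_fst_add_snd_of_hasFDerivAt hderiv.hasFDerivAt] at hderiv
  all_goals
    filter_upwards [hmem] with x hx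
    simp [chartMul, ← he, e.left_inv h1, e.right_inv hx]

lemma exists_mem_nhds_isAlmostAdditiveOn
    (hmul : HasStrictFDerivAt (chartMul E G)
      (ContinuousLinearMap.fst 𝕜 E E + ContinuousLinearMap.snd 𝕜 E E)
      (chartAt E (1 : G) 1, chartAt E (1 : G) 1)) {c : ℝ≥0} (hc : 0 < c) :
    ∃ A ∈ nhds (1 : G),
      IsAlmostAdditiveOn c (fun g => chartAt E (1 : G) g - chartAt E (1 : G) 1) A := by
  obtain ⟨S, hS, happrox⟩ := hmul.approximates_deriv_on_nhds (Or.inr hc)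
  set e := chartAt E (1 : G) with he
  have h1 : (1 : G) ∈ e.source := mem_chart_source _ _
  rw [nhds_prod_eq, Filter.mem_prod_same_iff] at hS
  obtain ⟨T, hT, hTS⟩ := hS
  refine ⟨e.source ∩ e ⁻¹' T, Filter.inter_mem (e.open_source.mem_nhds h1)
    ((e.continuousAt h1).preimage_mem_nhds hT), sub_self _, ?_⟩
  rintro g ⟨hg, hgT⟩ h ⟨hh, hhT⟩ g' ⟨hg', hgT'⟩ h' ⟨hh', hhT'⟩
  simpa [chartMul, ← he, e.left_inv hg, e.left_inv hh, e.left_inv hg', e.left_inv hh',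
    Prod.norm_def] using happrox (e g, e h) (hTS ⟨hgT, hhT⟩) (e g', e h') (hTS ⟨hgT', hhT'⟩)

end Chart

lemma exists_isCompact_isOpen_subset_of_mem_nhds (E : Type*) {X : Type*} [NormedAddCommGroup E]
    [IsUltrametricDist E] [ProperSpace E] [TopologicalSpace X] [ChartedSpace E X] {x : X}
    {A : Set X} (hA : A ∈ nhds x) : ∃ W ⊆ A, x ∈ W ∧ IsCompact W ∧ IsOpen W := by
  let e := chartAt E x
  have hx : x ∈ e.source := mem_chart_source E x
  have hex : e x ∈ e.target := e.map_source hx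
  have hmem : e.target ∩ e.symm ⁻¹' A ∈ nhds (e x) :=
    Filter.inter_mem (e.open_target.mem_nhds hex)
      ((e.continuousAt_symm hex).preimage_mem_nhds (by rwa [e.left_inv hx]))
  obtain ⟨r, hr, hball⟩ := Metric.nhds_basis_closedBall.mem_iff.1 hmem
  refine ⟨e.symm '' Metric.closedBall (e x) r, Set.image_subset_iff.2 fun y hy => (hball hy).2,
    ⟨e x, Metric.mem_closedBall_self hr.le, e.left_inv hx⟩, ?_, ?_⟩
  · exact (isCompact_closedBall _ _).image_of_continuousOn
      (e.continuousOn_symm.mono fun y hy => (hball hy).1)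
  · exact e.isOpen_image_symm_of_subset_target
      (IsUltrametricDist.isOpen_closedBall _ hr.ne') fun y hy => (hball hy).1

open scoped Pointwise in
lemma exists_isOpen_subgroup_subset {G : Type*} [Group G] [TopologicalSpace G]
    [IsTopologicalGroup G] {W : Set G} (hW : IsCompact W) (hW' : IsOpen W) (h1 : 1 ∈ W) :
    ∃ K : Subgroup G, IsOpen (K : Set G) ∧ (K : Set G) ⊆ W := by
  refine ⟨MulAction.stabilizer G W, ?_, fun g hg => ?_⟩
  · obtain ⟨V, hV, hVW⟩ := compact_open_separated_mul_left hW hW' subset_rfl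
    refine Subgroup.isOpen_of_mem_nhds _ (g := 1) ?_
    have hsub : ∀ g ∈ V, g • W ⊆ W := fun g hg => (Set.smul_set_subset_mul hg).trans hVW
    filter_upwards [hV, inv_mem_nhds_one G hV] with g hg hg'
    exact (hsub g hg).antisymm (Set.subset_smul_set_iff.2 (hsub g⁻¹ hg'))
  · rw [← MulAction.mem_stabilizer_iff.1 hg]
    exact ⟨1, h1, mul_one g⟩

namespace IsPadicAnalyticGroup

variable {p : ℕ} [Fact p.Prime] {G : Type*} [Group G] [TopologicalSpace G]

lemma t2Space [IsTopologicalGroup G] (hG : IsPadicAnalyticGroup p G) : T2Space G := by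
  obtain ⟨d, _, _⟩ := hG
  have : T1Space G := ChartedSpace.t1Space (Fin d → ℚ_[p]) G
  infer_instance

theorem procyclicSubgroupsDetectOpen [IsTopologicalGroup G] (hG : IsPadicAnalyticGroup p G) :
    ProcyclicSubgroupsDetectOpen G := by
  obtain ⟨d, _, _⟩ := hG
  let e := chartAt (Fin d → ℚ_[p]) (1 : G)
  have hp : 0 < ‖(p : ℚ_[p])‖₊ := nnnorm_pos.2 (Nat.cast_ne_zero.2 (Fact.out : p.Prime).ne_zero)
  obtain ⟨A, hA, hadd⟩ := exists_mem_nhds_isAlmostAdditiveOn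
    (hasStrictFDerivAt_chartMul ℚ_[p] (Fin d → ℚ_[p]) G) (pow_pos hp 2)
  have hAe : A ∩ e.source ∈ nhds (1 : G) :=
    Filter.inter_mem hA (e.open_source.mem_nhds (mem_chart_source _ _))
  obtain ⟨W, hWA, h1W, hW, hW'⟩ :=
    exists_isCompact_isOpen_subset_of_mem_nhds (Fin d → ℚ_[p]) hAe
  obtain ⟨K, hK', hKW⟩ := exists_isOpen_subgroup_subset hW hW' h1W
  have hK : IsCompact (K : Set G) := hW.of_isClosed_subset (K.isClosed_of_isOpen hK') hKW
  have hKA : (K : Set G) ⊆ A := fun g hg => (hWA (hKW hg)).1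
  have hKe : (K : Set G) ⊆ e.source := fun g hg => (hWA (hKW hg)).2
  refine ⟨K, hK, hK', fun H hH => (hadd.mono hKA le_rfl).isOpen_of_forall_exists_pow_mem hK hK'
    ((e.continuousOn.mono hKe).sub continuousOn_const)
    ((sub_left_injective.injOn (s := Set.univ)).comp (e.injOn.mono hKe) fun _ _ => trivial) ?_ hH⟩
  have himage : IsOpen ((fun g => e g - e 1) '' (K : Set G)) := by
    rw [← Set.image_image (· - e 1)]
    exact (Homeomorph.subRight (e 1)).isOpenMap _ (e.isOpen_image_of_subset_source hK' hKe)
  exact himage.mem_nhds ⟨1, K.one_mem, sub_self _⟩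

end IsPadicAnalyticGroup

namespace SmoothRep

variable {k : Type u} [Field k] {G : Type v} [Group G]

lemma rep_exact_iff_function_exact (S : ShortComplex (Rep.{w} k G)) :
    S.Exact ↔ Function.Exact S.f.hom S.g.hom := by
  rw [← S.exact_map_iff_of_faithful (forget₂ (Rep.{w} k G) (ModuleCat k)),
    ShortComplex.ShortExact.moduleCat_exact_iff_function_exact]
  rfl

variable [TopologicalSpace G] [IsTopologicalGroup G]

variable (k G) in
instance preservesHomology_ι : (IsSmooth.{u, v, w} k G).ι.PreservesHomology where
  preservesKernels _ _ f := ObjectProperty.preservesKernels_ι _ f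
  preservesCokernels _ _ f := ObjectProperty.preservesCokernels_ι _ f

lemma smRep_exact_iff_function_exact (S : ShortComplex (SmRep.{u, v, w} k G)) :
    S.Exact ↔ Function.Exact S.f.hom.hom S.g.hom.hom := by
  rw [← S.exact_map_iff_of_faithful (IsSmooth.{u, v, w} k G).ι, rep_exact_iff_function_exact]
  rfl

lemma IsSmooth.isSmoothVector {V : Rep.{w} k G} (hV : IsSmooth k G V) (x : V) :
    IsSmoothVector V.ρ x := by
  obtain ⟨K, hK, h⟩ := (isSmooth_iff V).1 hV x
  exact Subgroup.isOpen_mono (H₁ := K) h hK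

lemma mem_smoothPart_iff_isSmoothVector
    (hG : ∃ K : Subgroup G, IsCompact (K : Set G) ∧ IsOpen (K : Set G)) {V : Rep.{w} k G} {x : V} :
    x ∈ smoothPart V ↔ IsSmoothVector V.ρ x := by
  constructor
  · intro hx
    obtain ⟨K, hK, h⟩ := exists_isOpen_of_mem_smoothPart V hx
    exact Subgroup.isOpen_mono (H₁ := K) h hK
  · intro hx
    obtain ⟨K, hK, hK'⟩ := hG
    refine (mem_smoothPart_iff ⟨K, hK, hK'⟩).2
      ⟨K ⊓ vectorStabilizer V.ρ x, ?_, ?_, fun g hg => hg.2⟩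
    · rw [Subgroup.coe_inf]
      exact hK.inter_right (Subgroup.isClosed_of_isOpen _ hx)
    · rw [Subgroup.coe_inf]
      exact hK'.inter hx

variable [T2Space G]

lemma mem_smoothPart_of_map_mem (hG : ProcyclicSubgroupsDetectOpen G) (hk : 0 < ringChar k)
    {V I J : Rep.{w} k G} (hV : IsSmooth k G V) (i : V ⟶ I) (f : I ⟶ J)
    (hif : Function.Exact i.hom f.hom) {y : I} (hy : f.hom y ∈ smoothPart J) :
    y ∈ smoothPart I := by
  have hK : ∃ K : Subgroup G, IsCompact (K : Set G) ∧ IsOpen (K : Set G) :=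
    hG.imp fun _ h => ⟨h.1, h.2.1⟩
  rw [mem_smoothPart_iff_isSmoothVector hK] at hy ⊢
  refine isSmoothVector_of_isSmoothVector_sub hG hk (ringChar.Nat.cast_ringChar (R := k)) hy
    fun g hg => ?_
  have hker : f.hom (I.ρ g y - y) = 0 := by
    rw [map_sub, Rep.hom_comm_apply f g y, sub_eq_zero]
    exact hg
  obtain ⟨x, hx⟩ := (hif _).1 hker
  refine (hV.isSmoothVector x).of_le fun a ha => ?_
  rw [mem_vectorStabilizer] at ha ⊢
  rw [← hx, ← Rep.hom_comm_apply i a x, ha]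

end SmoothRep

theorem theorem4p1_general (G : Type v) [Group G] [TopologicalSpace G] [IsTopologicalGroup G]
    [T2Space G] (hG : ProcyclicSubgroupsDetectOpen G) (k : Type u) [Field k] (hk : 0 < ringChar k)
    (V : SmoothRep.SmRep.{u, v, max u v w} k G) :
    IsZero (((SmoothRep.smoothFunctor.{u, v, max u v w} k G).rightDerived 1).obj V.obj) := by
  let I := injectiveResolution V.obj
  refine IsZero.of_iso ?_ (I.isoRightDerivedObj (SmoothRep.smoothFunctor k G) 1)
  refine (HomologicalComplex.exactAt_iff_isZero_homology _ _).1 ?_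
  rw [HomologicalComplex.exactAt_iff' _ 0 1 2 (by simp) (by simp),
    SmoothRep.smRep_exact_iff_function_exact]
  have hker : Function.Exact (I.ι.f 0).hom (I.cocomplex.d 0 1).hom :=
    (SmoothRep.rep_exact_iff_function_exact _).1 I.exact₀
  have hexact : Function.Exact (I.cocomplex.d 0 1).hom (I.cocomplex.d 1 2).hom :=
    (SmoothRep.rep_exact_iff_function_exact _).1 (I.exact_succ 0)
  rintro ⟨x, hx⟩
  constructor
  · intro h
    obtain ⟨y, rfl⟩ := (hexact x).1 (congrArg Subtype.val h)
    exact ⟨⟨y, SmoothRep.mem_smoothPart_of_map_mem hG hk V.property _ _ hker hx⟩, rfl⟩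
  · rintro ⟨⟨y, _⟩, h⟩
    exact Subtype.ext ((hexact x).2 ⟨y, congrArg Subtype.val h⟩)

theorem theorem4p1 (p : ℕ) [Fact p.Prime] (G : Type v) [Group G] [TopologicalSpace G]
    [IsTopologicalGroup G] (hG : IsPadicAnalyticGroup p G)
    (k : Type u) [Field k] (hk : 0 < ringChar k)
    (V : SmoothRep.SmRep.{u, v, max u v w} k G) :
    IsZero (((SmoothRep.smoothFunctor.{u, v, max u v w} k G).rightDerived 1).obj V.obj) := by
  have : T2Space G := hG.t2Space
  exact theorem4p1_general.{u, v, w} G hG.procyclicSubgroupsDetectOpen k hk V
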